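/- Let $s,r\ge 1$ and let $a_1,\dots,a_r\ge 0$ be integers, put $a_0=0$, and let $X=\mathbb{P}\left(\mathcal{O}_{\mathbb{P}^s}\oplus\bigoplus_{i=1}^r\mathcal{O}_{\mathbb{P}^s}(a_i)\right)$ be the complex projective bundle of one-dimensional quotients, with projection $\pi:X\to\mathbb{P}^s$. (This includes all Fano bundles of this form, that is, those with $\sum_i a_i\le s$; the Fano condition is not needed.) Let $H$ be the hyperplane class of $\mathbb{P}^s$, let $\xi$ be the class of the tautological line bundle $\mathcal{O}_X(1)$, and for $k,l\in\mathbb{Z}$ let $L_{kl}=k\,\pi^*H+l\,\xi\in \mathrm{Pic}(X)$. View $X$ as a toric variety whose fan in $\mathbb{Z}^{s+r}$ has the rays generated by the standard basis vectors $v_1,\dots,v_s,e_1,\dots,e_r$ and by $v_0=-\sum_{i=1}^s v_i+\sum_{j=1}^r a_je_j$ and $e_0=-\sum_{j=1}^r e_j$. For a ray generator $\rho$ let $V_X(\rho)\subset X$ be the corresponding toric prime divisor, i.e. the closure of the torus orbit of $\rho$. Then for all $k,l\in\mathbb{Z}$ the complex vector space $H^0(X,L_{kl})$ has a basis indexed by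 the set of effective toric divisors $$\left\{\sum_{i=0}^s n_iV_X(v_i)+\sum_{j=0}^r m_jV_X(e_j)\ \middle|\ n_i,m_j\in\mathbb{Z}_{\ge 0},\ \sum_{j=0}^r m_j=l,\ \sum_{i=0}^s n_i=k+\sum_{j=0}^r m_ja_j\right\},$$ such that the basis section indexed by a divisor $D$ has zero divisor $D$. -/

import Mathlib

open Filter Topology
open scoped TensorProduct LinearAlgebra.Projectivization

noncomputable section

namespace ProjBundle

section Lines

variable {V : Type*} [AddCommGroup V] [Module ℂ V]

/-- The nonzero vectors of the line in `V` that is the point `p` of `ℙ(V)`. -/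
abbrev Punctured (p : ℙ ℂ V) : Type _ := {v : V // v ≠ 0 ∧ v ∈ p.submodule}

/-- The fibre at `p` of the line bundle `𝒪(d)` on the space `ℙ(V)` of lines in `V`, for an integer
`d`: functions on the line `p` without its origin that are homogeneous of degree `d`.
For `d = 1` this is the dual of the line `p`. -/
def twistFibre (d : ℤ) (p : ℙ ℂ V) : Submodule ℂ (Punctured p → ℂ) where
  carrier := {φ | ∀ (t : ℂ) (v v' : Punctured p), (v' : V) = t • (v : V) → φ v' = t ^ d * φ v}
  add_mem' := by
    intro φ ψ hφ hψ t v v' h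
    simp only [Pi.add_apply, hφ t v v' h, hψ t v v' h, mul_add]
  zero_mem' := by
    intro t v v' _
    simp
  smul_mem' := by
    intro c φ hφ t v v' h
    simp only [Pi.smul_apply, smul_eq_mul, hφ t v v' h, mul_left_comm]

/-- Evaluation of the elements of the fibre `𝒪(d)_p` at a nonzero vector of the line `p`. -/
def evalAt (d : ℤ) {p : ℙ ℂ V} (v : Punctured p) : twistFibre d p →ₗ[ℂ] ℂ :=
  LinearMap.proj v ∘ₗ (twistFibre d p).subtype

/-- A nonzero vector, seen as a vector of the line it spans. -/
def selfVec (v : V) (hv : v ≠ 0) : Punctured (Projectivization.mk ℂ v hv) :=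
  ⟨v, hv, Submodule.mem_span_singleton_self v⟩

theorem exists_evalAt_eq_one (d : ℤ) {p : ℙ ℂ V} (v : Punctured p) :
    ∃ φ : twistFibre d p, evalAt d v φ = 1 := by
  have hspan : ∀ w : Punctured p, ∃ t : ℂ, t • (v : V) = w := by
    obtain ⟨v, hv0, hv⟩ := v
    rintro ⟨w, -, hw⟩
    induction p with
    | h u hu =>
      rw [Projectivization.submodule_mk] at hv hw
      obtain ⟨b, rfl⟩ := Submodule.mem_span_singleton.1 hv
      obtain ⟨c, rfl⟩ := Submodule.mem_span_singleton.1 hw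
      have hb : b ≠ 0 := by
        rintro rfl
        exact hv0 (zero_smul ℂ u)
      exact ⟨c / b, by rw [smul_smul, div_mul_cancel₀ c hb]⟩
  choose τ hτ using hspan
  refine ⟨⟨fun w => τ w ^ d, ?_⟩, ?_⟩
  · intro t w w' h
    have h1 : τ w' • (v : V) = (t * τ w) • (v : V) := by rw [hτ, h, mul_smul, hτ]
    change τ w' ^ d = t ^ d * τ w ^ d
    rw [smul_left_injective ℂ v.2.1 h1, mul_zpow]
  · have h1 : τ v • (v : V) = (1 : ℂ) • (v : V) := by rw [hτ, one_smul]
    change τ v ^ d = 1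
    rw [smul_left_injective ℂ v.2.1 h1, one_zpow]

end Lines

/-- The degrees `(a_0, a_1, …, a_r)`, where `a_0 = 0`. -/
def deg {r : ℕ} (a : Fin r → ℕ) : Fin (r + 1) → ℕ := Fin.cons 0 a

variable {s r : ℕ} (a : Fin r → ℕ)

/-- The fibre at `p ∈ ℙˢ` of the bundle `E = 𝒪 ⊕ 𝒪(a_1) ⊕ ⋯ ⊕ 𝒪(a_r)`. -/
abbrev bundleFibre (p : ℙ ℂ (Fin (s + 1) → ℂ)) : Type :=
  (j : Fin (r + 1)) → twistFibre (deg a j : ℤ) p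

/-- The (closed) points of the projective bundle `ℙ(E)` over `ℙˢ`, where `ℙ(E)` is the bundle of
one-dimensional quotients of `E`, that is, of lines in the dual of `E`. -/
abbrev Space (s : ℕ) {r : ℕ} (a : Fin r → ℕ) : Type :=
  Σ p : ℙ ℂ (Fin (s + 1) → ℂ), ℙ ℂ (Module.Dual ℂ (bundleFibre a p))

/-- The fibre at `x` of the line bundle `k π^*H + l ξ` on `ℙ(E)`, that is, of
`π^*𝒪(k) ⊗ 𝒪_{ℙ(E)}(l)`. -/
def lineFibre (k l : ℤ) (x : Space s a) : Type :=
  twistFibre k x.1 ⊗[ℂ] twistFibre l x.2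

instance (k l : ℤ) (x : Space s a) : AddCommGroup (lineFibre a k l x) :=
  inferInstanceAs (AddCommGroup (twistFibre k x.1 ⊗[ℂ] twistFibre l x.2))

instance (k l : ℤ) (x : Space s a) : Module ℂ (lineFibre a k l x) :=
  inferInstanceAs (Module ℂ (twistFibre k x.1 ⊗[ℂ] twistFibre l x.2))

/-- The value of an element of the fibre of `k π^*H + l ξ` at a nonzero vector of the line `x.1`
and a nonzero vector of the line `x.2`. -/
def evalPair (k l : ℤ) {x : Space s a} (v : Punctured x.1) (w : Punctured x.2) :
    lineFibre a k l x →ₗ[ℂ] ℂ :=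
  LinearMap.mul' ℂ ℂ ∘ₗ TensorProduct.map (evalAt k v) (evalAt l w)

/-- The linear form `φ ↦ ∑ y_j φ_j(v)` on the fibre of `E` at the point `p` of `ℙˢ`, where `v` is a
nonzero vector of the line `p`. -/
def coordForm {p : ℙ ℂ (Fin (s + 1) → ℂ)} (v : Punctured p) (y : Fin (r + 1) → ℂ) :
    Module.Dual ℂ (bundleFibre a p) :=
  ∑ j, y j • (evalAt (deg a j : ℤ) v ∘ₗ LinearMap.proj j)

theorem coordForm_ne_zero {p : ℙ ℂ (Fin (s + 1) → ℂ)} (v : Punctured p) (y : Fin (r + 1) → ℂ)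
    (hy : y ≠ 0) : coordForm a v y ≠ 0 := by
  intro h
  apply hy
  funext j
  obtain ⟨φ, hφ⟩ := exists_evalAt_eq_one (deg a j : ℤ) v
  have h1 := LinearMap.congr_fun h (Pi.single j φ)
  rw [coordForm, LinearMap.sum_apply, Finset.sum_eq_single j] at h1
  · simpa [hφ] using h1
  · intro i _ hij
    simp [Pi.single_eq_of_ne hij]
  · simp

/-- The point of `ℙ(E)` with homogeneous coordinates `(v, y)`. -/
def pt (v : Fin (s + 1) → ℂ) (hv : v ≠ 0) (y : Fin (r + 1) → ℂ) (hy : y ≠ 0) : Space s a :=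
  ⟨Projectivization.mk ℂ v hv, Projectivization.mk ℂ (coordForm a (selfVec v hv) y)
    (coordForm_ne_zero a (selfVec v hv) y hy)⟩

/-- Coordinates on the affine space `𝔸^{s+r}`. -/
abbrev Coord (s r : ℕ) : Type := Fin s ⊕ Fin r

/-- The labels `(i, j)` of the standard affine charts of `ℙ(E)`: on the chart `(i, j)` the
homogeneous coordinates `v_i` and `y_j` are invertible, and they are normalized to `1`. -/
abbrev ChartIndex (s r : ℕ) : Type := Fin (s + 1) × Fin (r + 1)

def chartBase (c : ChartIndex s r) (q : Coord s r → ℂ) : Fin (s + 1) → ℂ :=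
  c.1.insertNth (α := fun _ => ℂ) 1 (fun i => q (Sum.inl i))

def chartFibre (c : ChartIndex s r) (q : Coord s r → ℂ) : Fin (r + 1) → ℂ :=
  c.2.insertNth (α := fun _ => ℂ) 1 (fun j => q (Sum.inr j))

theorem chartBase_ne_zero (c : ChartIndex s r) (q : Coord s r → ℂ) : chartBase c q ≠ 0 := by
  intro h
  have h1 := congrFun h c.1
  simp [chartBase] at h1

theorem chartFibre_ne_zero (c : ChartIndex s r) (q : Coord s r → ℂ) : chartFibre c q ≠ 0 := by
  intro h
  have h1 := congrFun h c.2
  simp [chartFibre] at h1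

/-- The standard affine charts `𝔸^{s+r} → ℙ(E)`. They form an atlas of `ℙ(E)` as an algebraic
variety over `ℂ`. -/
def chart (c : ChartIndex s r) (q : Coord s r → ℂ) : Space s a :=
  pt a (chartBase c q) (chartBase_ne_zero c q) (chartFibre c q) (chartFibre_ne_zero c q)

/-- The trivialization of `k π^*H + l ξ` over a standard chart: evaluation at the normalized
homogeneous coordinates. -/
def localTriv (k l : ℤ) (c : ChartIndex s r) (q : Coord s r → ℂ) :
    lineFibre a k l (chart a c q) →ₗ[ℂ] ℂ :=
  evalPair a k l (x := chart a c q) (selfVec (chartBase c q) (chartBase_ne_zero c q))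
    (selfVec (coordForm a (selfVec (chartBase c q) (chartBase_ne_zero c q)) (chartFibre c q))
      (coordForm_ne_zero a _ _ (chartFibre_ne_zero c q)))

/-- The expression of a section of `k π^*H + l ξ` in a standard chart. -/
def localExpr {k l : ℤ} (σ : (x : Space s a) → lineFibre a k l x) (c : ChartIndex s r)
    (q : Coord s r → ℂ) : ℂ :=
  localTriv a k l c q (σ (chart a c q))

/-- The space `H⁰(X, k π^*H + l ξ)` of global sections, `X = ℙ(E)`: the sections that are regular,
that is, given by a polynomial in every standard affine chart. -/
def globalSections (s : ℕ) {r : ℕ} (a : Fin r → ℕ) (k l : ℤ) :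
    Submodule ℂ ((x : Space s a) → lineFibre a k l x) where
  carrier := {σ | ∀ c : ChartIndex s r, ∃ f : MvPolynomial (Coord s r) ℂ,
    ∀ q, MvPolynomial.eval q f = localExpr a σ c q}
  add_mem' := by
    intro σ τ hσ hτ c
    obtain ⟨f, hf⟩ := hσ c
    obtain ⟨g, hg⟩ := hτ c
    refine ⟨f + g, fun q => ?_⟩
    rw [map_add, hf, hg]
    exact (map_add (localTriv a k l c q) _ _).symm
  zero_mem' := fun c => ⟨0, fun q => by
    rw [map_zero]
    exact (map_zero (localTriv a k l c q)).symm⟩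
  smul_mem' := by
    intro t σ hσ c
    obtain ⟨f, hf⟩ := hσ c
    refine ⟨t • f, fun q => ?_⟩
    rw [MvPolynomial.smul_eval, hf]
    exact (map_smul (localTriv a k l c q) t _).symm

/-! ### The toric structure -/

/-- The labels of the rays of the fan of `X`: `Sum.inl i` for `v_i`, where `0 ≤ i ≤ s`, and
`Sum.inr j` for `e_j`, where `0 ≤ j ≤ r`. -/
abbrev Ray (s r : ℕ) : Type := Fin (s + 1) ⊕ Fin (r + 1)

/-- The generators of the rays in the lattice `ℤ^{s+r}`: the standard basis vectors
`v_1, …, v_s, e_1, …, e_r` and `v_0 = - ∑ v_i + ∑ a_j e_j`, `e_0 = - ∑ e_j`. -/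
def rayGen : Ray s r → Coord s r → ℤ
  | Sum.inl i => Fin.cases (motive := fun _ => Coord s r → ℤ)
      (Sum.elim (fun _ => -1) (fun j => (a j : ℤ))) (fun i' => Pi.single (Sum.inl i') 1) i
  | Sum.inr j => Fin.cases (motive := fun _ => Coord s r → ℤ)
      (Sum.elim (fun _ => 0) (fun _ => -1)) (fun j' => Pi.single (Sum.inr j') 1) j

/-- For `t ≠ 0`, the point `z · λ(t)` of the torus `(ℂ^*)^{s+r} ⊆ X`, where `λ(t) = t ^ u` is the
one-parameter subgroup that belongs to the lattice vector `u`. The torus is the set of the points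
of the chart `(0, 0)` with nonzero coordinates. -/
def torusCurve (u : Coord s r → ℤ) (z : Coord s r → ℂˣ) (t : ℂ) : Space s a :=
  chart a (0, 0) (fun κ => (z κ : ℂ) * t ^ u κ)

/-- The point `x` is the limit of `γ t` as `t → 0`, `t ≠ 0`, in the complex manifold `X`. -/
def IsLimitAtZero (γ : ℂ → Space s a) (x : Space s a) : Prop :=
  ∃ (c : ChartIndex s r) (g : ℂ → Coord s r → ℂ) (q : Coord s r → ℂ),
    (∀ᶠ t in 𝓝[≠] (0 : ℂ), γ t = chart a c (g t)) ∧ Tendsto g (𝓝[≠] 0) (𝓝 q) ∧ x = chart a c q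

/-- The torus orbit that corresponds to the ray `ρ`: the points `lim_{t → 0} z · λ_ρ(t)`, for `z` in
the torus and `λ_ρ` the one-parameter subgroup of the generator of `ρ`. -/
def rayOrbit (ρ : Ray s r) : Set (Space s a) :=
  {x | ∃ z : Coord s r → ℂˣ, IsLimitAtZero a (torusCurve a (rayGen a ρ) z) x}

/-- Zariski closed subsets of `X`: those that are algebraic sets in every standard affine chart. -/
def IsZariskiClosed (Z : Set (Space s a)) : Prop :=
  ∀ c : ChartIndex s r, ∃ I : Ideal (MvPolynomial (Coord s r) ℂ),
    chart a c ⁻¹' Z = MvPolynomial.zeroLocus ℂ I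

/-- The toric prime divisor `V_X(ρ)` of the ray `ρ`: the Zariski closure of the orbit of `ρ`. -/
def primeDivisor (ρ : Ray s r) : Set (Space s a) :=
  ⋂₀ {Z | IsZariskiClosed a Z ∧ rayOrbit a ρ ⊆ Z}

/-- The semigroup of effective toric divisors of `X`; the function `D` is the divisor
`∑ n_i V_X(v_i) + ∑ m_j V_X(e_j)`, where `n_i = D (Sum.inl i)` and `m_j = D (Sum.inr j)`. -/
abbrev EffectiveToricDivisor (s r : ℕ) : Type := Ray s r → ℕ

/-- The zero divisor of the section `σ` is `D = ∑ d_ρ V_X(ρ)`: in every standard affine chart, `σ` is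
a polynomial that generates the ideal of the effective divisor `D`, the product of the powers
`I(V_X(ρ)) ^ d_ρ` of the ideals of the prime divisors. -/
def HasZeroDivisor {k l : ℤ} (σ : (x : Space s a) → lineFibre a k l x)
    (D : EffectiveToricDivisor s r) : Prop :=
  ∀ c : ChartIndex s r, ∃ f : MvPolynomial (Coord s r) ℂ,
    (∀ q, MvPolynomial.eval q f = localExpr a σ c q) ∧
    Ideal.span {f} =
      ∏ ρ : Ray s r, MvPolynomial.vanishingIdeal ℂ (chart a c ⁻¹' primeDivisor a ρ) ^ D ρ

/-- The effective toric divisors `∑ n_i V_X(v_i) + ∑ m_j V_X(e_j)` with `|m| = l` and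
`|n| = k + ∑ m_j a_j`. -/
def divisorSet (s : ℕ) {r : ℕ} (a : Fin r → ℕ) (k l : ℤ) : Set (EffectiveToricDivisor s r) :=
  {D | ∑ j, (D (Sum.inr j) : ℤ) = l ∧
    ∑ i, (D (Sum.inl i) : ℤ) = k + ∑ j, (D (Sum.inr j) : ℤ) * (deg a j : ℤ)}

end ProjBundle

end

/-!
The bundle `ℙ(E)` has homogeneous (Cox) coordinates `(v, y)`, one coordinate for each ray of the
fan, subject to `v ≠ 0`, `y ≠ 0`. Two coordinate vectors give the same point exactly when they differ
by `v ↦ t v`, `y_j ↦ u t ^ (-a_j) y_j` (`coordPt_eq_iff`), and sections of `k π^*H + l ξ` are the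
functions of `(v, y)` that are homogeneous of degree `k` in `t` and `l` in `u` (`sectionEval`,
`exists_sectionEval_eq`). The monomial `∏ h_ρ ^ D_ρ` has this bidegree exactly when `D` is in
`divisorSet s a k l`, and these monomials are the basis.

*Zero divisors.* Up to rescaling, the one-parameter subgroup of the ray `ρ` multiplies the homogeneous
coordinate `h_ρ` by `t` (`torusCurve_eq_coordPt`). Hence the orbit of `ρ` is contained in the locus
`h_ρ = 0` and contains the points where only `h_ρ` vanishes; the latter are dense, so
`V_X(ρ) = {h_ρ = 0}` (`primeDivisor_eq_rayHyperplane`). In a standard chart `h_ρ` is a variable or `1`,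
so its ideal is generated by `h_ρ` (`vanishingIdeal_primeDivisor`), and the zero divisor of a monomial
can be read off its exponents.

*Basis.* A global section is determined by its restriction to the torus of homogeneous coordinates
(`torusRestrict_injective`). As the section is polynomial in the chart `c`, this restriction is a
combination of Laurent monomials of bidegree `(k, l)` whose exponents are nonnegative at the rays that
are coordinates of `c` (`torusRestrict_mem_span`). Characters are linearly independent, so the
combination is the same for all charts; since `s, r ≥ 1`, every ray is a coordinate of some chart, and
only honest monomials occur (`torusRestrict_mem_span_monomial`). Linear independence of the monomial
sections is again that of characters.
-/

open scoped TensorProduct LinearAlgebra.Projectivization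

noncomputable section

namespace ProjBundle

section

/-! ### Fibres of the line bundles -/

section Lines

variable {V : Type*} [AddCommGroup V] [Module ℂ V]

theorem exists_eq_smul {p : ℙ ℂ V} (v w : Punctured p) :
    ∃ t : ℂ, t ≠ 0 ∧ (w : V) = t • (v : V) := by
  obtain ⟨v, hv0, hv⟩ := v
  obtain ⟨w, hw0, hw⟩ := w
  induction p with
  | h u hu =>
    rw [Projectivization.submodule_mk] at hv hw
    obtain ⟨b, rfl⟩ := Submodule.mem_span_singleton.1 hv
    obtain ⟨c, rfl⟩ := Submodule.mem_span_singleton.1 hw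
    have hb : b ≠ 0 := fun h => hv0 (by rw [h, zero_smul])
    have hc : c ≠ 0 := fun h => hw0 (by rw [h, zero_smul])
    exact ⟨c / b, div_ne_zero hc hb, by simp [smul_smul, hb]⟩

theorem nonempty_punctured (p : ℙ ℂ V) : Nonempty (Punctured p) :=
  ⟨p.rep, p.rep_nonzero, p.submodule_eq ▸ Submodule.mem_span_singleton_self _⟩

theorem eq_mk_of_mem {p : ℙ ℂ V} {v : V} (hv : v ≠ 0) (hp : v ∈ p.submodule) :
    p = Projectivization.mk ℂ v hv := by
  obtain ⟨t, -, h⟩ := exists_eq_smul (⟨v, hv, hp⟩ : Punctured p)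
    ⟨p.rep, p.rep_nonzero, p.submodule_eq ▸ Submodule.mem_span_singleton_self _⟩
  exact p.mk_rep.symm.trans ((Projectivization.mk_eq_mk_iff' ..).2 ⟨t, h.symm⟩)

theorem evalAt_eq_zpow_mul (d : ℤ) {p : ℙ ℂ V} {v w : Punctured p} {t : ℂ}
    (h : (w : V) = t • (v : V)) (φ : twistFibre d p) : evalAt d w φ = t ^ d * evalAt d v φ :=
  φ.2 t v w h

theorem evalAt_bijective (d : ℤ) {p : ℙ ℂ V} (v : Punctured p) :
    Function.Bijective (evalAt d v) := by
  constructor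
  · rw [← LinearMap.ker_eq_bot, LinearMap.ker_eq_bot']
    intro φ hφ
    ext w
    obtain ⟨t, -, h⟩ := exists_eq_smul v w
    change evalAt d w φ = 0
    rw [evalAt_eq_zpow_mul d h, hφ, mul_zero]
  · intro z
    obtain ⟨φ, hφ⟩ := exists_evalAt_eq_one d v
    exact ⟨z • φ, by simp [hφ]⟩

/-- Evaluation at a nonzero vector of the line `p` identifies the fibre `𝒪(d)_p` with `ℂ`. -/
def evalEquiv (d : ℤ) {p : ℙ ℂ V} (v : Punctured p) : twistFibre d p ≃ₗ[ℂ] ℂ :=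
  LinearEquiv.ofBijective (evalAt d v) (evalAt_bijective d v)

theorem mul'_map_evalAt_rescale {W : Type*} [AddCommGroup W] [Module ℂ W] (k l : ℤ) {p : ℙ ℂ V}
    {q : ℙ ℂ W} {v v' : Punctured p} {w w' : Punctured q} {t u : ℂ}
    (hv : (v' : V) = t • (v : V)) (hw : (w' : W) = u • (w : W)) :
    LinearMap.mul' ℂ ℂ ∘ₗ TensorProduct.map (evalAt k v') (evalAt l w') =
      (t ^ k * u ^ l) • (LinearMap.mul' ℂ ℂ ∘ₗ TensorProduct.map (evalAt k v) (evalAt l w)) := by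
  have h1 : evalAt k v' = t ^ k • evalAt k v := LinearMap.ext (evalAt_eq_zpow_mul k hv)
  have h2 : evalAt l w' = u ^ l • evalAt l w := LinearMap.ext (evalAt_eq_zpow_mul l hw)
  rw [h1, h2, TensorProduct.map_smul_left, TensorProduct.map_smul_right, LinearMap.comp_smul,
    LinearMap.comp_smul, smul_smul]

end Lines

variable {s r : ℕ} (a : Fin r → ℕ)

theorem evalPair_bijective (k l : ℤ) {x : Space s a} (v : Punctured x.1) (w : Punctured x.2) :
    Function.Bijective (evalPair a k l v w) :=
  (TensorProduct.congr (evalEquiv k v) (evalEquiv l w) ≪≫ₗ TensorProduct.lid ℂ ℂ).bijective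

theorem evalPair_rescale (k l : ℤ) {x : Space s a} {v v' : Punctured x.1} {w w' : Punctured x.2}
    {t u : ℂ} (hv : (v' : Fin (s + 1) → ℂ) = t • (v : Fin (s + 1) → ℂ))
    (hw : (w' : Module.Dual ℂ (bundleFibre a x.1)) = u • (w : Module.Dual ℂ (bundleFibre a x.1)))
    (z : lineFibre a k l x) :
    evalPair a k l v' w' z = t ^ k * u ^ l * evalPair a k l v w z := by
  exact LinearMap.congr_fun (mul'_map_evalAt_rescale k l hv hw) z

/-! ### Homogeneous coordinates -/

theorem coordForm_apply {p : ℙ ℂ (Fin (s + 1) → ℂ)} (v : Punctured p) (y : Fin (r + 1) → ℂ)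
    (φ : bundleFibre a p) : coordForm a v y φ = ∑ j, y j * evalAt (deg a j : ℤ) v (φ j) := by
  simp [coordForm, LinearMap.sum_apply]

theorem coordForm_zero {p : ℙ ℂ (Fin (s + 1) → ℂ)} (v : Punctured p) : coordForm a v 0 = 0 :=
  LinearMap.ext fun φ => by simp [coordForm_apply]

theorem coordForm_injective {p : ℙ ℂ (Fin (s + 1) → ℂ)} (v : Punctured p) :
    Function.Injective (coordForm a v) := by
  intro y y' h
  by_contra hne
  refine coordForm_ne_zero a v (y - y') (sub_ne_zero.2 hne) ?_
  refine LinearMap.ext fun φ => ?_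
  have := LinearMap.congr_fun h φ
  simp only [coordForm_apply] at this ⊢
  simp [sub_mul, this]

theorem coordForm_surjective {p : ℙ ℂ (Fin (s + 1) → ℂ)} (v : Punctured p) :
    Function.Surjective (coordForm a v) := by
  intro w
  refine ⟨fun j => w (Pi.single j ((evalEquiv (deg a j : ℤ) v).symm 1)), ?_⟩
  refine LinearMap.ext fun φ => ?_
  rw [coordForm_apply]
  have hφ : φ = ∑ j, evalAt (deg a j : ℤ) v (φ j) •
      (Pi.single j ((evalEquiv (deg a j : ℤ) v).symm 1) : bundleFibre a p) := by
    funext j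
    rw [Finset.sum_apply, Finset.sum_eq_single j]
    · apply (evalAt_bijective (deg a j : ℤ) v).1
      have h1 : evalAt (deg a j : ℤ) v ((evalEquiv (deg a j : ℤ) v).symm 1) = 1 :=
        (evalEquiv (deg a j : ℤ) v).apply_symm_apply 1
      simp [h1]
    · intro i _ hij
      simp [Pi.single_eq_of_ne hij.symm]
    · simp
  conv_rhs => rw [hφ, map_sum]
  refine Finset.sum_congr rfl fun j _ => ?_
  rw [map_smul, smul_eq_mul, mul_comm]

theorem coordForm_rescale {p : ℙ ℂ (Fin (s + 1) → ℂ)} {v v' : Punctured p}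
    {y y' : Fin (r + 1) → ℂ} {t u : ℂ}
    (hv : (v' : Fin (s + 1) → ℂ) = t • (v : Fin (s + 1) → ℂ)) :
    coordForm a v' y' = u • coordForm a v y ↔ ∀ j, t ^ deg a j * y' j = u * y j := by
  have h1 : coordForm a v' y' = coordForm a v (fun j => t ^ deg a j * y' j) := by
    refine LinearMap.ext fun φ => ?_
    simp only [coordForm_apply, evalAt_eq_zpow_mul _ hv, zpow_natCast]
    exact Finset.sum_congr rfl fun j _ => by ring
  have h2 : u • coordForm a v y = coordForm a v (fun j => u * y j) := by
    refine LinearMap.ext fun φ => ?_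
    simp only [coordForm_apply, LinearMap.smul_apply, smul_eq_mul, Finset.mul_sum, mul_assoc]
  rw [h1, h2, (coordForm_injective a v).eq_iff]
  exact funext_iff

/-- Homogeneous (Cox) coordinates for `ℙ(E)`, one for each ray of the fan: the vector of the first
`s + 1` coordinates and the vector of the last `r + 1` coordinates are both nonzero. -/
abbrev HomCoord (s r : ℕ) : Type :=
  {h : Ray s r → ℂ // h ∘ Sum.inl ≠ 0 ∧ h ∘ Sum.inr ≠ 0}

/-- The point of `ℙ(E)` with given homogeneous coordinates. -/
def coordPt (h : HomCoord s r) : Space s a :=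
  pt a (h.1 ∘ Sum.inl) h.2.1 (h.1 ∘ Sum.inr) h.2.2

/-- The normalized homogeneous coordinates of the points of a standard chart. -/
def chartCoord (c : ChartIndex s r) (q : Coord s r → ℂ) : HomCoord s r :=
  ⟨Sum.elim (chartBase c q) (chartFibre c q), chartBase_ne_zero c q, chartFibre_ne_zero c q⟩

theorem chart_eq_coordPt (c : ChartIndex s r) (q : Coord s r → ℂ) :
    chart a c q = coordPt a (chartCoord c q) := rfl

/-- The action of the pair of scalars `(t, u)` on homogeneous coordinates takes `h` to `h'`: the
`v_i` have weight `1` under `t`, and the `y_j` have weight `-a_j` under `t` and `1` under `u`. -/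
structure Rescales (t u : ℂ) (h h' : Ray s r → ℂ) : Prop where
  fst_ne_zero : t ≠ 0
  snd_ne_zero : u ≠ 0
  base : ∀ i, h' (Sum.inl i) = t * h (Sum.inl i)
  fibre : ∀ j, t ^ deg a j * h' (Sum.inr j) = u * h (Sum.inr j)

/-- The coordinates `h` give a vector of the line `x.1` and a linear form in the line `x.2`, so that
they are homogeneous coordinates of `x`. Unlike an equality `x = coordPt a h`, this evaluates
elements of the fibres at `x` without transport along an equality of points. -/
structure IsCoord (h : HomCoord s r) (x : Space s a) : Prop where
  base_mem : h.1 ∘ Sum.inl ∈ x.1.submodule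
  form_mem : coordForm a (⟨h.1 ∘ Sum.inl, h.2.1, base_mem⟩ : Punctured x.1) (h.1 ∘ Sum.inr) ∈
    x.2.submodule

variable {a}

/-- The nonzero vector of the line `x.1` given by homogeneous coordinates of `x`. -/
def IsCoord.baseVec {h : HomCoord s r} {x : Space s a} (H : IsCoord a h x) : Punctured x.1 :=
  ⟨h.1 ∘ Sum.inl, h.2.1, H.base_mem⟩

/-- The nonzero vector of the line `x.2` given by homogeneous coordinates of `x`. -/
def IsCoord.formVec {h : HomCoord s r} {x : Space s a} (H : IsCoord a h x) : Punctured x.2 :=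
  ⟨coordForm a H.baseVec (h.1 ∘ Sum.inr), coordForm_ne_zero a _ _ h.2.2, H.form_mem⟩

theorem isCoord_coordPt (h : HomCoord s r) : IsCoord a h (coordPt a h) :=
  ⟨Submodule.mem_span_singleton_self _, Submodule.mem_span_singleton_self _⟩

variable (a)

/-- The value of a section of `k π^*H + l ξ` at homogeneous coordinates: the function on the
space of homogeneous coordinates that corresponds to the section. -/
def sectionEval {k l : ℤ} (σ : (x : Space s a) → lineFibre a k l x) (h : HomCoord s r) : ℂ :=
  evalPair a k l (isCoord_coordPt h).baseVec (isCoord_coordPt h).formVec (σ (coordPt a h))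

theorem localExpr_eq_sectionEval {k l : ℤ} (σ : (x : Space s a) → lineFibre a k l x)
    (c : ChartIndex s r) (q : Coord s r → ℂ) :
    localExpr a σ c q = sectionEval a σ (chartCoord c q) := rfl

variable {a}

theorem mk_eq_pt {p : ℙ ℂ (Fin (s + 1) → ℂ)} {P : ℙ ℂ (Module.Dual ℂ (bundleFibre a p))}
    {v : Fin (s + 1) → ℂ} {y : Fin (r + 1) → ℂ} (hv : v ≠ 0) (hy : y ≠ 0) (hp : v ∈ p.submodule)
    (hP : coordForm a (⟨v, hv, hp⟩ : Punctured p) y ∈ P.submodule) :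
    (⟨p, P⟩ : Space s a) = pt a v hv y hy := by
  obtain rfl := eq_mk_of_mem hv hp
  obtain rfl := eq_mk_of_mem (coordForm_ne_zero a _ _ hy) hP
  rfl

theorem IsCoord.eq_coordPt {h : HomCoord s r} {x : Space s a} (H : IsCoord a h x) :
    x = coordPt a h :=
  mk_eq_pt h.2.1 h.2.2 H.base_mem H.form_mem

theorem IsCoord.sectionEval_eq {k l : ℤ} (σ : (x : Space s a) → lineFibre a k l x)
    {h : HomCoord s r} {x : Space s a} (H : IsCoord a h x) :
    sectionEval a σ h = evalPair a k l H.baseVec H.formVec (σ x) := by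
  obtain rfl := H.eq_coordPt
  rfl

theorem isCoord_of_mem {x : Space s a} (v : Punctured x.1) (y : Fin (r + 1) → ℂ) (hy : y ≠ 0)
    (hw : coordForm a v y ∈ x.2.submodule) :
    IsCoord a (⟨Sum.elim v.1 y, v.2.1, hy⟩ : HomCoord s r) x :=
  ⟨v.2.2, hw⟩

theorem exists_isCoord (x : Space s a) : ∃ h : HomCoord s r, IsCoord a h x := by
  have v : Punctured x.1 := (nonempty_punctured x.1).some
  have w : Punctured x.2 := (nonempty_punctured x.2).some
  refine (coordForm_surjective a v w.1).elim fun y hy => ?_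
  have hy0 : y ≠ 0 := fun h => w.2.1 (hy.symm.trans ((congrArg _ h).trans (coordForm_zero a v)))
  have hm : coordForm a v y ∈ x.2.submodule := by
    rw [hy]
    exact w.2.2
  exact ⟨_, isCoord_of_mem v y hy0 hm⟩

theorem Rescales.isCoord {t u : ℂ} {h h' : HomCoord s r} (R : Rescales a t u h.1 h'.1)
    {x : Space s a} (H : IsCoord a h x) : IsCoord a h' x := by
  have hv : h'.1 ∘ Sum.inl = t • (h.1 ∘ Sum.inl) := funext R.base
  have hmem : h'.1 ∘ Sum.inl ∈ x.1.submodule := by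
    rw [hv]
    exact Submodule.smul_mem _ _ H.base_mem
  refine ⟨hmem, ?_⟩
  have hform := (coordForm_rescale a (v := H.baseVec) (v' := ⟨_, h'.2.1, hmem⟩)
    (y := h.1 ∘ Sum.inr) (y' := h'.1 ∘ Sum.inr) hv).2 R.fibre
  rw [hform]
  exact Submodule.smul_mem _ _ H.form_mem

theorem Rescales.sectionEval_eq {k l : ℤ} (σ : (x : Space s a) → lineFibre a k l x)
    {t u : ℂ} {h h' : HomCoord s r} (R : Rescales a t u h.1 h'.1) :
    sectionEval a σ h' = t ^ k * u ^ l * sectionEval a σ h := by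
  have hv : h'.1 ∘ Sum.inl = t • (h.1 ∘ Sum.inl) := funext R.base
  have H := isCoord_coordPt (a := a) h
  have H' := R.isCoord H
  have hform := (coordForm_rescale a (v := H.baseVec) (v' := H'.baseVec)
    (y := h.1 ∘ Sum.inr) (y' := h'.1 ∘ Sum.inr) hv).2 R.fibre
  rw [H'.sectionEval_eq σ]
  exact evalPair_rescale a k l (v := H.baseVec) (v' := H'.baseVec) (w := H.formVec)
    (w' := H'.formVec) hv hform _

/-- Homogeneous coordinates of the same point differ by a rescaling. -/
theorem IsCoord.exists_rescales {x : Space s a} {h h' : HomCoord s r} (H : IsCoord a h x)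
    (H' : IsCoord a h' x) : ∃ t u, Rescales a t u h.1 h'.1 := by
  obtain ⟨t, ht, h1⟩ := exists_eq_smul H.baseVec H'.baseVec
  obtain ⟨u, hu, h2⟩ := exists_eq_smul H.formVec H'.formVec
  exact ⟨t, u, ht, hu, fun i => congrFun h1 i, (coordForm_rescale a h1).1 h2⟩

theorem coordPt_eq_iff {h h' : HomCoord s r} :
    coordPt a h = coordPt a h' ↔ ∃ t u, Rescales a t u h.1 h'.1 :=
  ⟨fun heq => (isCoord_coordPt h).exists_rescales (heq ▸ isCoord_coordPt h'),
    fun ⟨_, _, R⟩ => (R.isCoord (isCoord_coordPt h)).eq_coordPt⟩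

/-- A function on the space of homogeneous coordinates that is homogeneous of bidegree `(k, l)`
comes from a section of `k π^*H + l ξ`. -/
theorem exists_sectionEval_eq {k l : ℤ} (F : HomCoord s r → ℂ)
    (hF : ∀ t u h h', Rescales a t u h.1 h'.1 → F h' = t ^ k * u ^ l * F h) :
    ∃ σ : (x : Space s a) → lineFibre a k l x, ∀ h, sectionEval a σ h = F h := by
  choose c hc using exists_isCoord (s := s) (a := a)
  choose σ hσ using fun x => (evalPair_bijective a k l (hc x).baseVec (hc x).formVec).2 (F (c x))
  refine ⟨σ, fun h => ?_⟩
  obtain ⟨t, u, R⟩ := (hc (coordPt a h)).exists_rescales (isCoord_coordPt h)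
  rw [hF _ _ _ _ R, R.sectionEval_eq, (hc (coordPt a h)).sectionEval_eq, hσ]

theorem section_eq_zero {k l : ℤ} {σ : (x : Space s a) → lineFibre a k l x}
    (hσ : ∀ h, sectionEval a σ h = 0) : σ = 0 := by
  funext x
  obtain ⟨h, H⟩ := exists_isCoord x
  exact (evalPair_bijective a k l H.baseVec H.formVec).1
    ((H.sectionEval_eq σ).symm.trans ((hσ h).trans (map_zero _).symm))

end

section

variable {s r : ℕ} {a : Fin r → ℕ}

/-! ### Homogeneous coordinates in the standard charts -/

/-- The ray whose homogeneous coordinate restricts to the affine coordinate `κ` of the chart `c`. -/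
def chartRay (c : ChartIndex s r) : Coord s r → Ray s r :=
  Sum.map c.1.succAbove c.2.succAbove

theorem chartRay_injective (c : ChartIndex s r) : Function.Injective (chartRay c) :=
  Sum.map_injective.2 ⟨Fin.succAbove_right_injective, Fin.succAbove_right_injective⟩

theorem ray_cases (c : ChartIndex s r) (ρ : Ray s r) :
    ρ = Sum.inl c.1 ∨ ρ = Sum.inr c.2 ∨ ∃ κ, ρ = chartRay c κ := by
  rcases ρ with i | j
  · rcases Fin.eq_self_or_eq_succAbove c.1 i with rfl | ⟨i', rfl⟩
    · exact .inl rfl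
    · exact .inr (.inr ⟨.inl i', rfl⟩)
  · rcases Fin.eq_self_or_eq_succAbove c.2 j with rfl | ⟨j', rfl⟩
    · exact .inr (.inl rfl)
    · exact .inr (.inr ⟨.inr j', rfl⟩)

@[simp]
theorem chartCoord_inl_self (c : ChartIndex s r) (q : Coord s r → ℂ) :
    (chartCoord c q).1 (Sum.inl c.1) = 1 := by
  simp [chartCoord, chartBase]

@[simp]
theorem chartCoord_inr_self (c : ChartIndex s r) (q : Coord s r → ℂ) :
    (chartCoord c q).1 (Sum.inr c.2) = 1 := by
  simp [chartCoord, chartFibre]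

@[simp]
theorem chartCoord_chartRay (c : ChartIndex s r) (q : Coord s r → ℂ) (κ : Coord s r) :
    (chartCoord c q).1 (chartRay c κ) = q κ := by
  rcases κ with i | j
  · simp [chartCoord, chartBase, chartRay]
  · simp [chartCoord, chartFibre, chartRay]

/-- The expression of a homogeneous coordinate in a standard chart: a variable or `1`. -/
def chartVar (c : ChartIndex s r) : Ray s r → MvPolynomial (Coord s r) ℂ :=
  Sum.elim
    (c.1.insertNth (α := fun _ => MvPolynomial (Coord s r) ℂ) 1
      (fun i => MvPolynomial.X (Sum.inl i)))
    (c.2.insertNth (α := fun _ => MvPolynomial (Coord s r) ℂ) 1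
      (fun j => MvPolynomial.X (Sum.inr j)))

@[simp]
theorem chartVar_inl_self (c : ChartIndex s r) : chartVar c (Sum.inl c.1) = 1 := by
  simp [chartVar]

@[simp]
theorem chartVar_inr_self (c : ChartIndex s r) : chartVar c (Sum.inr c.2) = 1 := by
  simp [chartVar]

@[simp]
theorem chartVar_chartRay (c : ChartIndex s r) (κ : Coord s r) :
    chartVar c (chartRay c κ) = MvPolynomial.X κ := by
  rcases κ with i | j <;> simp [chartVar, chartRay]

theorem eval_chartVar (c : ChartIndex s r) (q : Coord s r → ℂ) (ρ : Ray s r) :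
    MvPolynomial.eval q (chartVar c ρ) = (chartCoord c q).1 ρ := by
  rcases ray_cases c ρ with rfl | rfl | ⟨κ, rfl⟩ <;> simp

theorem continuous_chartCoord (c : ChartIndex s r) (ρ : Ray s r) :
    Continuous fun q : Coord s r → ℂ => (chartCoord c q).1 ρ := by
  simp only [← eval_chartVar]
  exact MvPolynomial.continuous_eval _

variable (a) in
/-- The affine coordinates on the chart `c` as functions of homogeneous coordinates. -/
def affineCoord (c : ChartIndex s r) (h : Ray s r → ℂ) : Coord s r → ℂ :=
  Sum.elim (fun i => h (Sum.inl (c.1.succAbove i)) / h (Sum.inl c.1))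
    (fun j => h (Sum.inl c.1) ^ deg a (c.2.succAbove j) * h (Sum.inr (c.2.succAbove j)) /
      (h (Sum.inl c.1) ^ deg a c.2 * h (Sum.inr c.2)))

theorem rescales_chartCoord_affineCoord (c : ChartIndex s r) {h : Ray s r → ℂ}
    (hv : h (Sum.inl c.1) ≠ 0) (hy : h (Sum.inr c.2) ≠ 0) :
    Rescales a (h (Sum.inl c.1)) (h (Sum.inl c.1) ^ deg a c.2 * h (Sum.inr c.2))
      (chartCoord c (affineCoord a c h)).1 h where
  fst_ne_zero := hv
  snd_ne_zero := mul_ne_zero (pow_ne_zero _ hv) hy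
  base i := by
    rcases Fin.eq_self_or_eq_succAbove c.1 i with rfl | ⟨i', rfl⟩
    · simp
    · have := chartCoord_chartRay c (affineCoord a c h) (Sum.inl i')
      simp only [chartRay, Sum.map_inl] at this
      rw [this, affineCoord, Sum.elim_inl, mul_div_cancel₀ _ hv]
  fibre j := by
    rcases Fin.eq_self_or_eq_succAbove c.2 j with rfl | ⟨j', rfl⟩
    · simp
    · have := chartCoord_chartRay c (affineCoord a c h) (Sum.inr j')
      simp only [chartRay, Sum.map_inr] at this
      rw [this, affineCoord, Sum.elim_inr, mul_div_cancel₀ _ (mul_ne_zero (pow_ne_zero _ hv) hy)]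

theorem exists_rescales_chartCoord (h : HomCoord s r) : ∃ c q t u,
    Rescales a t u (chartCoord c q).1 h.1 := by
  obtain ⟨i, hi⟩ := Function.ne_iff.1 h.2.1
  obtain ⟨j, hj⟩ := Function.ne_iff.1 h.2.2
  exact ⟨(i, j), _, _, _, rescales_chartCoord_affineCoord (i, j) hi hj⟩

theorem Rescales.eq_zero_iff {t u : ℂ} {h h' : Ray s r → ℂ} (R : Rescales a t u h h')
    (ρ : Ray s r) : h' ρ = 0 ↔ h ρ = 0 := by
  rcases ρ with i | j
  · rw [R.base, mul_eq_zero, or_iff_right R.fst_ne_zero]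
  · rw [← mul_eq_zero_iff_left (pow_ne_zero (deg a j) R.fst_ne_zero), R.fibre,
      mul_eq_zero_iff_left R.snd_ne_zero]

/-- A polynomial that vanishes at the points with nonzero coordinates outside `S` on a coordinate
subspace vanishes on this subspace. -/
theorem eval_eq_zero_of_forall_ne_zero {ι : Type*} [Finite ι] (S : Set ι) (f : MvPolynomial ι ℂ)
    (p : ι → ℂ) (H : ∀ q : ι → ℂ, (∀ κ ∈ S, q κ = p κ) → (∀ κ ∉ S, q κ ≠ 0) →
      MvPolynomial.eval q f = 0) : MvPolynomial.eval p f = 0 := by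
  classical
  let q : ℂ → ι → ℂ := fun ε κ => if κ ∈ S then p κ else p κ + ε
  have hq : Continuous q := by
    refine continuous_pi fun κ => ?_
    by_cases hκ : κ ∈ S
    · simpa only [q, hκ, if_true] using continuous_const
    · simpa only [q, hκ, if_false] using continuous_const_add (p κ)
  have hq0 : q 0 = p := by
    funext κ
    simp [q]
  have h1 : Tendsto (fun ε => MvPolynomial.eval (q ε) f) (𝓝[≠] 0) (𝓝 (MvPolynomial.eval p f)) := by
    have := ((MvPolynomial.continuous_eval f).comp hq).tendsto 0
    simp only [Function.comp_apply, hq0] at this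
    exact this.mono_left nhdsWithin_le_nhds
  have h2 : ∀ᶠ ε in 𝓝[≠] (0 : ℂ), ∀ κ, p κ + ε ≠ 0 := by
    refine eventually_all.2 fun κ => ?_
    by_cases hκ : p κ = 0
    · filter_upwards [self_mem_nhdsWithin] with ε hε
      simpa [hκ] using hε
    · have h : ContinuousAt (fun ε : ℂ => p κ + ε) 0 := by fun_prop
      exact (h.eventually_ne (by simpa using hκ)).filter_mono nhdsWithin_le_nhds
  refine tendsto_nhds_unique h1 (tendsto_const_nhds.congr' ?_)
  filter_upwards [h2] with ε hε
  refine (H _ (fun κ hκ => by simp [q, hκ]) fun κ hκ => ?_).symm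
  simpa [q, hκ] using hε κ

/-! ### The toric prime divisors are the coordinate hyperplanes -/

variable (a) in
/-- The locus in `ℙ(E)` where the homogeneous coordinate of the ray `ρ` vanishes. -/
def rayHyperplane (ρ : Ray s r) : Set (Space s a) :=
  {x | ∃ h : HomCoord s r, IsCoord a h x ∧ h.1 ρ = 0}

theorem coordPt_mem_rayHyperplane {ρ : Ray s r} {h : HomCoord s r} :
    coordPt a h ∈ rayHyperplane a ρ ↔ h.1 ρ = 0 := by
  refine ⟨?_, fun h0 => ⟨h, isCoord_coordPt h, h0⟩⟩
  rintro ⟨h', H, h0⟩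
  obtain ⟨t, u, R⟩ := H.exists_rescales (isCoord_coordPt h)
  exact (R.eq_zero_iff ρ).2 h0

theorem preimage_rayHyperplane (c : ChartIndex s r) (ρ : Ray s r) :
    chart a c ⁻¹' rayHyperplane a ρ =
      MvPolynomial.zeroLocus ℂ (Ideal.span {chartVar c ρ}) := by
  rw [MvPolynomial.zeroLocus_span]
  ext q
  rw [Set.mem_preimage, chart_eq_coordPt, coordPt_mem_rayHyperplane]
  simp [MvPolynomial.aeval_eq_eval, eval_chartVar]

/-- The coordinates `h` with the coordinate of the ray `ρ` multiplied by `t`. -/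
def scaleRay (ρ : Ray s r) (t : ℂ) (h : Ray s r → ℂ) : Ray s r → ℂ :=
  fun σ => if σ = ρ then t * h σ else h σ

theorem scaleRay_ne_zero {ρ : Ray s r} {t : ℂ} (ht : t ≠ 0) {h : Ray s r → ℂ} (hh : ∀ σ, h σ ≠ 0)
    (σ : Ray s r) : scaleRay ρ t h σ ≠ 0 := by
  rw [scaleRay]
  split_ifs
  · exact mul_ne_zero ht (hh σ)
  · exact hh σ

theorem Rescales.scaleRay {t u : ℂ} {h h' : Ray s r → ℂ} (R : Rescales a t u h h')
    (ρ : Ray s r) (τ : ℂ) : Rescales a t u (scaleRay ρ τ h) (scaleRay ρ τ h') where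
  fst_ne_zero := R.fst_ne_zero
  snd_ne_zero := R.snd_ne_zero
  base i := by
    simp only [ProjBundle.scaleRay]
    split_ifs
    · rw [R.base, mul_left_comm]
    · exact R.base i
  fibre j := by
    simp only [ProjBundle.scaleRay]
    split_ifs
    · rw [mul_left_comm, R.fibre, mul_left_comm]
    · exact R.fibre j

/-- Homogeneous coordinates of a point of the torus. -/
def torusCoord (h : Ray s r → ℂ) (hh : ∀ σ, h σ ≠ 0) : HomCoord s r :=
  ⟨h, fun h0 => hh (Sum.inl 0) (congrFun h0 0), fun h0 => hh (Sum.inr 0) (congrFun h0 0)⟩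

theorem chartCoord_ne_zero {c : ChartIndex s r} {q : Coord s r → ℂ} (hq : ∀ κ, q κ ≠ 0)
    (σ : Ray s r) : (chartCoord c q).1 σ ≠ 0 := by
  rcases ray_cases c σ with rfl | rfl | ⟨κ, rfl⟩ <;> simp [hq]

/-- In homogeneous coordinates, the one-parameter subgroup of the ray `ρ` scales the coordinate
of `ρ`. -/
theorem torusCurve_eq_coordPt (ρ : Ray s r) (z : Coord s r → ℂˣ) {t : ℂ} (ht : t ≠ 0) :
    torusCurve a (rayGen a ρ) z t = coordPt a (torusCoord _ (scaleRay_ne_zero (ρ := ρ) ht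
      (chartCoord_ne_zero (c := (0, 0)) (fun κ => (z κ).ne_zero)))) := by
  rw [torusCurve, chart_eq_coordPt, coordPt_eq_iff]
  -- The rays `v_0` and `e_0` scale a coordinate that is normalized in the chart `(0, 0)`, so that
  -- a rescaling by `t` is needed to return to normalized coordinates.
  refine ⟨if ρ = Sum.inl 0 then t else 1, if ρ = Sum.inr 0 then t else 1, ?_⟩
  rcases ρ with i | j
  · refine Fin.cases ?_ (fun i => ?_) i
    · refine ⟨by simpa using ht, by simp, fun i => ?_, fun j => ?_⟩
      · refine Fin.cases ?_ (fun i => ?_) i <;>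
          simp [torusCoord, scaleRay, chartCoord, chartBase, rayGen]
        field_simp
      · refine Fin.cases ?_ (fun j => ?_) j <;>
          simp [torusCoord, scaleRay, chartCoord, chartFibre, rayGen, deg, mul_comm]
    · refine ⟨by simp, by simp, fun i => ?_, fun j => ?_⟩
      · refine Fin.cases ?_ (fun i => ?_) i <;>
          simp [torusCoord, scaleRay, chartCoord, chartBase, rayGen, Fin.succ_ne_zero,
            (Fin.succ_ne_zero _).symm]
        split_ifs with h
        · simp [h, mul_comm]
        · simp [h]
      · refine Fin.cases ?_ (fun j => ?_) j <;>
          simp [torusCoord, scaleRay, chartCoord, chartFibre, rayGen]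
  · refine Fin.cases ?_ (fun j => ?_) j
    · refine ⟨by simp, by simpa using ht, fun i => ?_, fun j => ?_⟩
      · refine Fin.cases ?_ (fun i => ?_) i <;>
          simp [torusCoord, scaleRay, chartCoord, chartBase, rayGen]
      · refine Fin.cases ?_ (fun j => ?_) j <;>
          simp [torusCoord, scaleRay, chartCoord, chartFibre, rayGen]
        field_simp
    · refine ⟨by simp, by simp, fun i => ?_, fun j => ?_⟩
      · refine Fin.cases ?_ (fun i => ?_) i <;>
          simp [torusCoord, scaleRay, chartCoord, chartBase, rayGen]
      · refine Fin.cases ?_ (fun j => ?_) j <;>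
          simp [torusCoord, scaleRay, chartCoord, chartFibre, rayGen, Fin.succ_ne_zero,
            (Fin.succ_ne_zero _).symm]
        split_ifs with h
        · simp [h, mul_comm]
        · simp [h]

theorem exists_ne_of_pos {n : ℕ} (hn : 1 ≤ n) (i : Fin (n + 1)) : ∃ j, j ≠ i := by
  have : Nontrivial (Fin (n + 1)) := Fin.nontrivial_iff_two_le.2 (by omega)
  exact exists_ne i

theorem rayOrbit_subset_rayHyperplane (hs : 1 ≤ s) (hr : 1 ≤ r) (ρ : Ray s r) :
    rayOrbit a ρ ⊆ rayHyperplane a ρ := by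
  rintro x ⟨z, c, g, q, hγ, hg, rfl⟩
  rw [chart_eq_coordPt, coordPt_mem_rayHyperplane]
  set Z := (chartCoord (0, 0) fun κ => (z κ : ℂ)).1 with hZ
  have hZ0 : ∀ σ, Z σ ≠ 0 := chartCoord_ne_zero fun κ => (z κ).ne_zero
  have hW : ∀ σ, Tendsto (fun t => scaleRay ρ t Z σ) (𝓝[≠] 0) (𝓝 (scaleRay ρ 0 Z σ)) := by
    intro σ
    have : Continuous fun t => scaleRay ρ t Z σ := by
      by_cases h : σ = ρ
      · simpa only [scaleRay, h, if_true] using continuous_mul_const (Z ρ)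
      · simpa only [scaleRay, h, if_false] using continuous_const
    exact (this.tendsto 0).mono_left nhdsWithin_le_nhds
  have hC : ∀ σ, Tendsto (fun t => (chartCoord c (g t)).1 σ) (𝓝[≠] 0)
      (𝓝 ((chartCoord c q).1 σ)) := fun σ =>
    ((continuous_chartCoord c σ).tendsto q).comp hg
  have hR : ∀ᶠ t in 𝓝[≠] (0 : ℂ), ∃ τ u,
      Rescales a τ u (chartCoord c (g t)).1 (scaleRay ρ t Z) := by
    filter_upwards [hγ, self_mem_nhdsWithin] with t h1 h2
    rw [torusCurve_eq_coordPt ρ z h2, chart_eq_coordPt] at h1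
    exact coordPt_eq_iff.1 h1.symm
  -- The relations between the two systems of coordinates, cleared of denominators, persist in
  -- the limit.
  have hbase : ∀ i, (chartCoord c q).1 (Sum.inl i) * scaleRay ρ 0 Z (Sum.inl c.1) =
      scaleRay ρ 0 Z (Sum.inl i) := by
    intro i
    refine tendsto_nhds_unique ((hC _).mul (hW _)) ((hW (Sum.inl i)).congr' ?_)
    filter_upwards [hR] with t ht
    obtain ⟨τ, u, R⟩ := ht
    rw [R.base i, R.base c.1, chartCoord_inl_self, mul_one, mul_comm]
  have hfibre : ∀ j, (chartCoord c q).1 (Sum.inr j) *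
      (scaleRay ρ 0 Z (Sum.inl c.1) ^ deg a c.2 * scaleRay ρ 0 Z (Sum.inr c.2)) =
      scaleRay ρ 0 Z (Sum.inl c.1) ^ deg a j * scaleRay ρ 0 Z (Sum.inr j) := by
    intro j
    refine tendsto_nhds_unique ((hC _).mul (((hW _).pow _).mul (hW _)))
      ((((hW (Sum.inl c.1)).pow _).mul (hW (Sum.inr j))).congr' ?_)
    filter_upwards [hR] with t ht
    obtain ⟨τ, u, R⟩ := ht
    have h1 := R.fibre j
    have h2 := R.fibre c.2
    rw [chartCoord_inr_self, mul_one] at h2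
    rw [R.base c.1, chartCoord_inl_self, mul_one, h1, h2, mul_comm]
  have hself : scaleRay ρ 0 Z ρ = 0 := by simp [scaleRay]
  have hne : ∀ σ, σ ≠ ρ → scaleRay ρ 0 Z σ ≠ 0 := fun σ h => by simpa [scaleRay, h] using hZ0 σ
  rcases ρ with i | j
  · have hc : c.1 ≠ i := by
      rintro rfl
      obtain ⟨i', hi'⟩ := exists_ne_of_pos hs c.1
      have := hbase i'
      rw [hself, mul_zero] at this
      exact hne (Sum.inl i') (by simpa using hi') this.symm
    have := hbase i
    rw [hself, mul_eq_zero] at this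
    exact this.resolve_right (hne _ (by simpa using hc))
  · have hv : scaleRay (Sum.inr j) 0 Z (Sum.inl c.1) ≠ 0 := hne _ (by simp)
    have hc : c.2 ≠ j := by
      rintro rfl
      obtain ⟨j', hj'⟩ := exists_ne_of_pos hr c.2
      have := hfibre j'
      rw [hself, mul_zero, mul_zero] at this
      exact mul_ne_zero (pow_ne_zero _ hv) (hne (Sum.inr j') (by simpa using hj')) this.symm
    have := hfibre j
    rw [hself, mul_zero, mul_eq_zero] at this
    exact this.resolve_right (mul_ne_zero (pow_ne_zero _ hv) (hne _ (by simpa using hc)))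

/-- The points where only the coordinate of the ray `ρ` vanishes are in the orbit of `ρ`. -/
theorem chart_mem_rayOrbit (c : ChartIndex s r) (q : Coord s r → ℂ) (κ₀ : Coord s r)
    (h0 : q κ₀ = 0) (hq : ∀ κ, κ ≠ κ₀ → q κ ≠ 0) : chart a c q ∈ rayOrbit a (chartRay c κ₀) := by
  classical
  let g : ℂ → Coord s r → ℂ := fun t => Function.update q κ₀ t
  have hg : ∀ t, t ≠ 0 → ∀ κ, g t κ ≠ 0 := by
    intro t ht κ
    by_cases hκ : κ = κ₀
    · subst hκ
      simpa [g] using ht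
    · simpa [g, hκ] using hq κ hκ
  have hg1 := chartCoord_ne_zero (c := c) (hg 1 one_ne_zero)
  have hscale : ∀ t, (chartCoord c (g t)).1 = scaleRay (chartRay c κ₀) t (chartCoord c (g 1)).1 := by
    intro t
    funext σ
    rcases ray_cases c σ with rfl | rfl | ⟨κ, rfl⟩
    · have : Sum.inl c.1 ≠ chartRay c κ₀ := by rcases κ₀ with i | j <;> simp [chartRay]
      simp [scaleRay, this]
    · have : Sum.inr c.2 ≠ chartRay c κ₀ := by rcases κ₀ with i | j <;> simp [chartRay]
      simp [scaleRay, this]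
    · by_cases hκ : κ = κ₀
      · subst hκ
        simp [scaleRay, g]
      · simp [scaleRay, (chartRay_injective c).eq_iff, hκ, g]
  have R := rescales_chartCoord_affineCoord (a := a) (0, 0) (hg1 (Sum.inl 0)) (hg1 (Sum.inr 0))
  have hz : ∀ κ, affineCoord a (0, 0) (chartCoord c (g 1)).1 κ ≠ 0 := fun κ => by
    have h := (R.eq_zero_iff (chartRay (0, 0) κ)).not.1 (hg1 _)
    rwa [chartCoord_chartRay] at h
  refine ⟨fun κ => Units.mk0 _ (hz κ), c, g, q, ?_, ?_, rfl⟩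
  · filter_upwards [self_mem_nhdsWithin] with t ht
    rw [torusCurve_eq_coordPt _ _ ht, chart_eq_coordPt, coordPt_eq_iff]
    have := R.scaleRay (chartRay c κ₀) t
    rw [← hscale] at this
    exact ⟨_, _, this⟩
  · have hgc : Continuous g := continuous_const.update κ₀ continuous_id
    have := (hgc.tendsto 0).mono_left (nhdsWithin_le_nhds (s := {0}ᶜ))
    rwa [show g 0 = q by simp [g, ← h0]] at this

theorem primeDivisor_eq_rayHyperplane (hs : 1 ≤ s) (hr : 1 ≤ r) (ρ : Ray s r) :
    primeDivisor a ρ = rayHyperplane a ρ := by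
  refine subset_antisymm (Set.sInter_subset_of_mem
    ⟨fun c => ⟨_, preimage_rayHyperplane c ρ⟩, rayOrbit_subset_rayHyperplane hs hr ρ⟩) ?_
  rintro x ⟨h, H, h0⟩ Z ⟨hZ, hsub⟩
  obtain ⟨c, q, t, u, R⟩ := exists_rescales_chartCoord (a := a) h
  have hx : x = chart a c q := H.eq_coordPt.trans (coordPt_eq_iff.2 ⟨t, u, R⟩).symm
  rw [R.eq_zero_iff] at h0
  obtain ⟨κ, rfl⟩ : ∃ κ, ρ = chartRay c κ := by
    rcases ray_cases c ρ with rfl | rfl | h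
    · simp at h0
    · simp at h0
    · exact h
  rw [chartCoord_chartRay] at h0
  obtain ⟨I, hI⟩ := hZ c
  rw [hx]
  change q ∈ chart a c ⁻¹' Z
  rw [hI]
  intro f hf
  refine eval_eq_zero_of_forall_ne_zero {κ} f q fun q' h1 h2 => ?_
  have hq' : q' ∈ chart a c ⁻¹' Z :=
    hsub (chart_mem_rayOrbit c q' κ ((h1 κ rfl).trans h0) fun κ' h => h2 κ' h)
  rw [hI] at hq'
  exact hq' f hf

theorem vanishingIdeal_primeDivisor (hs : 1 ≤ s) (hr : 1 ≤ r) (c : ChartIndex s r)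
    (ρ : Ray s r) :
    MvPolynomial.vanishingIdeal ℂ (chart a c ⁻¹' primeDivisor a ρ) =
      Ideal.span {chartVar c ρ} := by
  rw [primeDivisor_eq_rayHyperplane hs hr, preimage_rayHyperplane,
    MvPolynomial.vanishingIdeal_zeroLocus_eq_radical]
  rcases ray_cases c ρ with rfl | rfl | ⟨κ, rfl⟩
  · simp [Ideal.radical_top]
  · simp [Ideal.radical_top]
  · rw [chartVar_chartRay]
    exact ((Ideal.span_singleton_prime (MvPolynomial.X_ne_zero κ)).2
      MvPolynomial.X_prime).isRadical.radical

end

section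

variable {s r : ℕ} {a : Fin r → ℕ} {k l : ℤ}

/-! ### Monomial sections -/

theorem Rescales.prod_pow {t u : ℂ} {h h' : Ray s r → ℂ} (R : Rescales a t u h h')
    {D : EffectiveToricDivisor s r} (hD : D ∈ divisorSet s a k l) :
    ∏ ρ, h' ρ ^ D ρ = t ^ k * u ^ l * ∏ ρ, h ρ ^ D ρ := by
  have ht := R.fst_ne_zero
  have hfib : ∀ j, t ^ (deg a j * D (Sum.inr j)) * h' (Sum.inr j) ^ D (Sum.inr j) =
      u ^ D (Sum.inr j) * h (Sum.inr j) ^ D (Sum.inr j) := fun j => by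
    rw [pow_mul, ← mul_pow, R.fibre, mul_pow]
  have hprod : t ^ (∑ j, deg a j * D (Sum.inr j)) * ∏ ρ, h' ρ ^ D ρ =
      t ^ (∑ i, D (Sum.inl i)) * u ^ (∑ j, D (Sum.inr j)) * ∏ ρ, h ρ ^ D ρ := by
    have h2 := Finset.prod_congr (rfl : Finset.univ = Finset.univ) fun j _ => hfib j
    rw [Finset.prod_mul_distrib, Finset.prod_mul_distrib, Finset.prod_pow_eq_pow_sum,
      Finset.prod_pow_eq_pow_sum] at h2
    simp only [Fintype.prod_sum_type, R.base, mul_pow, Finset.prod_mul_distrib,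
      Finset.prod_pow_eq_pow_sum]
    linear_combination (t ^ (∑ i, D (Sum.inl i)) * ∏ i, h (Sum.inl i) ^ D (Sum.inl i)) * h2
  have hk : k = ((∑ i, D (Sum.inl i) : ℕ) : ℤ) - ((∑ j, deg a j * D (Sum.inr j) : ℕ) : ℤ) := by
    have := hD.2
    push_cast
    simp only [mul_comm (deg a _ : ℤ)]
    linarith
  have hl : l = ((∑ j, D (Sum.inr j) : ℕ) : ℤ) := by
    rw [← hD.1]
    push_cast
    rfl
  rw [hk, hl, zpow_sub₀ ht, zpow_natCast, zpow_natCast, zpow_natCast]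
  have := pow_ne_zero (∑ j, deg a j * D (Sum.inr j)) ht
  field_simp
  linear_combination hprod

theorem exists_monomialSection (D : divisorSet s a k l) :
    ∃ σ : (x : Space s a) → lineFibre a k l x,
      ∀ h, sectionEval a σ h = ∏ ρ, h.1 ρ ^ (D : EffectiveToricDivisor s r) ρ :=
  exists_sectionEval_eq _ fun _ _ _ _ R => R.prod_pow D.2

theorem eval_prod_chartVar (c : ChartIndex s r) (q : Coord s r → ℂ)
    (D : EffectiveToricDivisor s r) :
    MvPolynomial.eval q (∏ ρ, chartVar c ρ ^ D ρ) = ∏ ρ, (chartCoord c q).1 ρ ^ D ρ := by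
  simp [map_prod, eval_chartVar]

/-- The section of `k π^*H + l ξ` given by the monomial in the homogeneous coordinates whose
exponents are the coefficients of the divisor `D`. -/
def monomialSection (D : divisorSet s a k l) : globalSections s a k l :=
  ⟨(exists_monomialSection D).choose, fun c =>
    ⟨∏ ρ, chartVar c ρ ^ (D : EffectiveToricDivisor s r) ρ, fun q => by
      rw [eval_prod_chartVar, localExpr_eq_sectionEval, (exists_monomialSection D).choose_spec]⟩⟩

theorem sectionEval_monomialSection (D : divisorSet s a k l) (h : HomCoord s r) :
    sectionEval a (monomialSection D).1 h =
      ∏ ρ, h.1 ρ ^ (D : EffectiveToricDivisor s r) ρ :=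
  (exists_monomialSection D).choose_spec h

theorem hasZeroDivisor_monomialSection (hs : 1 ≤ s) (hr : 1 ≤ r) (D : divisorSet s a k l) :
    HasZeroDivisor a (monomialSection D).1 (D : EffectiveToricDivisor s r) := by
  intro c
  refine ⟨∏ ρ, chartVar c ρ ^ (D : EffectiveToricDivisor s r) ρ, fun q => ?_, ?_⟩
  · rw [eval_prod_chartVar, localExpr_eq_sectionEval, sectionEval_monomialSection]
  · simp only [vanishingIdeal_primeDivisor hs hr, Ideal.span_singleton_pow,
      Ideal.prod_span_singleton]

/-! ### Characters of the torus of homogeneous coordinates -/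

/-- The character `x ↦ ∏ x_ρ ^ e_ρ` of the torus of homogeneous coordinates. -/
def character (e : Ray s r → ℤ) : (Ray s r → ℂˣ) →* ℂˣ where
  toFun x := ∏ ρ, x ρ ^ e ρ
  map_one' := by simp
  map_mul' x y := by simp [mul_zpow, Finset.prod_mul_distrib]

theorem character_apply (e : Ray s r → ℤ) (x : Ray s r → ℂˣ) :
    character e x = ∏ ρ, x ρ ^ e ρ := rfl

/-- The characters as complex functions. -/
def characterFun (e : Ray s r → ℤ) (x : Ray s r → ℂˣ) : ℂ := (character e x : ℂ)

theorem linearIndependent_characterFun :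
    LinearIndependent ℂ (characterFun : (Ray s r → ℤ) → (Ray s r → ℂˣ) → ℂ) := by
  refine (linearIndependent_monoidHom (Ray s r → ℂˣ) ℂ).comp
    (fun e : Ray s r → ℤ => (Units.coeHom ℂ).comp (character e)) fun e e' h => ?_
  funext ρ
  -- Evaluate at the point with coordinate `2` at `ρ` and `1` elsewhere.
  have h1 := DFunLike.congr_fun h (Pi.mulSingle ρ (Units.mk0 2 two_ne_zero))
  have key : ∀ e : Ray s r → ℤ, character e (Pi.mulSingle ρ (Units.mk0 2 two_ne_zero)) =
      (Units.mk0 2 two_ne_zero : ℂˣ) ^ e ρ := by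
    intro e
    rw [character_apply, Finset.prod_eq_single ρ]
    · simp
    · intro σ _ hσ
      simp [hσ]
    · simp
  simp only [MonoidHom.comp_apply, key, Units.coeHom_apply, Units.val_zpow_eq_zpow_val,
    Units.val_mk0] at h1
  have h2 : (2 : ℝ) ^ e ρ = (2 : ℝ) ^ e' ρ := by simpa [norm_zpow] using congrArg norm h1
  exact zpow_right_injective₀ two_pos (by norm_num) h2

theorem character_add (e e' : Ray s r → ℤ) (x : Ray s r → ℂˣ) :
    character (e + e') x = character e x * character e' x := by
  simp [character_apply, zpow_add, Finset.prod_mul_distrib]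

theorem character_zsmul (n : ℤ) (e : Ray s r → ℤ) (x : Ray s r → ℂˣ) :
    character (n • e) x = character e x ^ n := by
  simp only [character_apply, Pi.smul_apply, smul_eq_mul, mul_comm n, zpow_mul,
    Finset.prod_zpow]

theorem character_sub (e e' : Ray s r → ℤ) (x : Ray s r → ℂˣ) :
    character (e - e') x = character e x / character e' x := by
  simp [character_apply, zpow_sub, Finset.prod_mul_distrib, div_eq_mul_inv]

theorem character_single (ρ : Ray s r) (x : Ray s r → ℂˣ) :
    character (Pi.single ρ 1) x = x ρ := by
  rw [character_apply, Finset.prod_eq_single ρ]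
  · simp
  · intro σ _ hσ
    simp [hσ]
  · simp

theorem character_sum {ι : Type*} (S : Finset ι) (e : ι → Ray s r → ℤ) (x : Ray s r → ℂˣ) :
    character (∑ i ∈ S, e i) x = ∏ i ∈ S, character (e i) x := by
  classical
  induction S using Finset.induction_on with
  | empty => simp [character_apply]
  | insert i S hi ih => rw [Finset.sum_insert hi, Finset.prod_insert hi, character_add, ih]

variable (s a) in
/-- The degree in `Pic X = ℤ π^*H ⊕ ℤ ξ` of a Laurent monomial in the homogeneous coordinates. -/
def bidegree : (Ray s r → ℤ) →ₗ[ℤ] ℤ × ℤ :=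
  LinearMap.prod
    (∑ i, LinearMap.proj (Sum.inl i) - ∑ j, (deg a j : ℤ) • LinearMap.proj (Sum.inr j))
    (∑ j, LinearMap.proj (Sum.inr j))

theorem bidegree_apply (e : Ray s r → ℤ) : bidegree s a e =
    (∑ i, e (Sum.inl i) - ∑ j, (deg a j : ℤ) * e (Sum.inr j), ∑ j, e (Sum.inr j)) := by
  simp [bidegree]

theorem bidegree_single_inl (i : Fin (s + 1)) :
    bidegree s a (Pi.single (Sum.inl i) 1) = (1, 0) := by
  simp [bidegree_apply, Pi.single_apply]

theorem bidegree_single_inr (j : Fin (r + 1)) :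
    bidegree s a (Pi.single (Sum.inr j) 1) = (-(deg a j : ℤ), 1) := by
  simp [bidegree_apply, Pi.single_apply]

/-- The exponent vector of an affine coordinate of a chart, as a Laurent monomial in the homogeneous
coordinates. -/
def coordExponent (a : Fin r → ℕ) (c : ChartIndex s r) : Coord s r → Ray s r → ℤ
  | Sum.inl i => Pi.single (Sum.inl (c.1.succAbove i)) 1 - Pi.single (Sum.inl c.1) 1
  | Sum.inr j => Pi.single (Sum.inr (c.2.succAbove j)) 1 - Pi.single (Sum.inr c.2) 1 +
      ((deg a (c.2.succAbove j) : ℤ) - deg a c.2) • Pi.single (Sum.inl c.1) 1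

theorem bidegree_coordExponent (c : ChartIndex s r) (κ : Coord s r) :
    bidegree s a (coordExponent a c κ) = 0 := by
  rcases κ with i | j
  · rw [coordExponent, map_sub, bidegree_single_inl, bidegree_single_inl, sub_self]
  · rw [coordExponent, map_add, map_sub, map_smul, bidegree_single_inl, bidegree_single_inr,
      bidegree_single_inr]
    ext <;> simp

theorem coordExponent_nonneg (c : ChartIndex s r) (κ κ' : Coord s r) :
    0 ≤ coordExponent a c κ (chartRay c κ') := by
  rcases κ with i | j <;> rcases κ' with i' | j' <;>
    simp [coordExponent, chartRay, Pi.single_apply]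
  · split_ifs <;> simp
  · split_ifs <;> simp

theorem character_coordExponent (c : ChartIndex s r) (κ : Coord s r) (x : Ray s r → ℂˣ) :
    (character (coordExponent a c κ) x : ℂ) = affineCoord a c (fun ρ => (x ρ : ℂ)) κ := by
  rcases κ with i | j
  · simp [coordExponent, affineCoord, character_sub, character_single]
  · simp only [coordExponent, affineCoord, character_sub, character_single, character_add,
      character_zsmul, zpow_sub, zpow_natCast, Sum.elim_inr]
    push_cast
    have h1 := (x (Sum.inl c.1)).ne_zero
    have h2 := (x (Sum.inr c.2)).ne_zero
    field_simp

/-- The exponent vector of the Laurent monomial of bidegree `(k, l)` that restricts to `1` on a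
chart. -/
def unitExponent (a : Fin r → ℕ) (k l : ℤ) (c : ChartIndex s r) : Ray s r → ℤ :=
  (k + l * deg a c.2) • Pi.single (Sum.inl c.1) 1 + l • Pi.single (Sum.inr c.2) 1

theorem bidegree_unitExponent (c : ChartIndex s r) :
    bidegree s a (unitExponent a k l c) = (k, l) := by
  rw [unitExponent, map_add, map_smul, map_smul, bidegree_single_inl, bidegree_single_inr]
  ext <;> simp

theorem unitExponent_chartRay (c : ChartIndex s r) (κ : Coord s r) :
    unitExponent a k l c (chartRay c κ) = 0 := by
  rcases κ with i | j <;> simp [unitExponent, chartRay]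

theorem character_unitExponent (c : ChartIndex s r) (x : Ray s r → ℂˣ) :
    (character (unitExponent a k l c) x : ℂ) =
      (x (Sum.inl c.1) : ℂ) ^ k * ((x (Sum.inl c.1) : ℂ) ^ deg a c.2 * x (Sum.inr c.2)) ^ l := by
  rw [unitExponent, character_add, character_zsmul, character_zsmul, character_single,
    character_single, mul_zpow, zpow_add, mul_comm l, zpow_mul, zpow_natCast]
  push_cast
  ring

/-! ### Restriction of sections to the torus -/

/-- The restriction of a global section to the torus of homogeneous coordinates. -/
def torusRestrict : globalSections s a k l →ₗ[ℂ] (Ray s r → ℂˣ) → ℂ where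
  toFun σ x := sectionEval a σ.1 (torusCoord (fun ρ => (x ρ : ℂ)) fun ρ => (x ρ).ne_zero)
  map_add' _ _ := funext fun _ => map_add (evalPair a k l _ _) _ _
  map_smul' _ _ := funext fun _ => map_smul (evalPair a k l _ _) _ _

theorem torusRestrict_apply (σ : globalSections s a k l) (x : Ray s r → ℂˣ) :
    torusRestrict σ x =
      sectionEval a σ.1 (torusCoord (fun ρ => (x ρ : ℂ)) fun ρ => (x ρ).ne_zero) := rfl

theorem torusRestrict_injective :
    Function.Injective (torusRestrict : globalSections s a k l →ₗ[ℂ] _) := by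
  rw [← LinearMap.ker_eq_bot, LinearMap.ker_eq_bot']
  intro σ hσ
  refine Subtype.ext (section_eq_zero fun h => ?_)
  obtain ⟨c, q, t, u, R⟩ := exists_rescales_chartCoord (a := a) h
  obtain ⟨f, hf⟩ := σ.2 c
  rw [R.sectionEval_eq, ← localExpr_eq_sectionEval, ← hf,
    eval_eq_zero_of_forall_ne_zero ∅ f q fun q' _ hq' => ?_, mul_zero]
  rw [hf, localExpr_eq_sectionEval]
  exact congrFun hσ fun ρ => Units.mk0 _ (chartCoord_ne_zero (c := c) (fun κ => hq' κ id) ρ)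

theorem torusRestrict_monomialSection (D : divisorSet s a k l) :
    torusRestrict (monomialSection D) =
      characterFun fun ρ => ((D : EffectiveToricDivisor s r) ρ : ℤ) := by
  funext x
  rw [torusRestrict_apply, sectionEval_monomialSection, characterFun, character_apply]
  push_cast
  simp only [zpow_natCast]
  rfl

variable (a k l) in
/-- The exponents of the Laurent monomials of bidegree `(k, l)` that are regular on a chart. -/
def chartExponents (c : ChartIndex s r) : Set (Ray s r → ℤ) :=
  {e | bidegree s a e = (k, l) ∧ ∀ κ, 0 ≤ e (chartRay c κ)}

theorem torusRestrict_mem_span (σ : globalSections s a k l) (c : ChartIndex s r) :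
    torusRestrict σ ∈ Submodule.span ℂ (characterFun '' chartExponents a k l c) := by
  obtain ⟨f, hf⟩ := σ.2 c
  let e : (Coord s r →₀ ℕ) → Ray s r → ℤ := fun α =>
    unitExponent a k l c + ∑ κ, (α κ : ℤ) • coordExponent a c κ
  have he : ∀ α, e α ∈ chartExponents a k l c := by
    refine fun α => ⟨?_, fun κ => ?_⟩
    · simp only [e, map_add, map_sum, map_smul, bidegree_coordExponent, smul_zero,
        Finset.sum_const_zero, add_zero, bidegree_unitExponent]
    · simp only [e, Pi.add_apply, unitExponent_chartRay, zero_add, Finset.sum_apply,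
        Pi.smul_apply, smul_eq_mul]
      exact Finset.sum_nonneg fun κ' _ => mul_nonneg (by positivity) (coordExponent_nonneg c κ' κ)
  have hσ : torusRestrict σ = ∑ α ∈ f.support, f.coeff α • characterFun (e α) := by
    funext x
    have R := rescales_chartCoord_affineCoord (a := a) c (h := fun ρ => (x ρ : ℂ))
      (x _).ne_zero (x _).ne_zero
    rw [torusRestrict_apply, Rescales.sectionEval_eq σ.1
      (h := chartCoord c (affineCoord a c fun ρ => (x ρ : ℂ))) R, ← localExpr_eq_sectionEval, ← hf,
      MvPolynomial.eval_eq', Finset.sum_apply, Finset.mul_sum]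
    refine Finset.sum_congr rfl fun α _ => ?_
    rw [Pi.smul_apply, smul_eq_mul, characterFun, character_add, character_sum, Units.val_mul,
      character_unitExponent]
    simp only [character_zsmul, zpow_natCast, Units.coe_prod, Units.val_pow_eq_pow_val,
      character_coordExponent]
    ring
  rw [hσ]
  exact Submodule.sum_mem _ fun α _ => Submodule.smul_mem _ _
    (Submodule.subset_span (Set.mem_image_of_mem _ (he α)))

/-- A Laurent monomial that is regular on every chart has nonnegative exponents, because every
homogeneous coordinate vanishes somewhere on some chart. -/
theorem exists_divisor_of_mem_chartExponents (hs : 1 ≤ s) (hr : 1 ≤ r) {e : Ray s r → ℤ}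
    (he : ∀ c, e ∈ chartExponents a k l c) :
    ∃ D : divisorSet s a k l, e = fun ρ => ((D : EffectiveToricDivisor s r) ρ : ℤ) := by
  have hpos : ∀ ρ, 0 ≤ e ρ := by
    intro ρ
    obtain ⟨c, κ, rfl⟩ : ∃ c κ, ρ = chartRay c κ := by
      rcases ρ with i | j
      · obtain ⟨i', hi'⟩ := exists_ne_of_pos hs i
        obtain ⟨κ, hκ⟩ := Fin.exists_succAbove_eq hi'.symm
        exact ⟨(i', 0), Sum.inl κ, by simp [chartRay, hκ]⟩
      · obtain ⟨j', hj'⟩ := exists_ne_of_pos hr j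
        obtain ⟨κ, hκ⟩ := Fin.exists_succAbove_eq hj'.symm
        exact ⟨(0, j'), Sum.inr κ, by simp [chartRay, hκ]⟩
    exact (he c).2 κ
  lift e to Ray s r → ℕ using hpos
  have h := (he (0, 0)).1
  rw [bidegree_apply, Prod.mk.injEq] at h
  refine ⟨⟨e, h.2, ?_⟩, rfl⟩
  simp only [mul_comm ((e _ : ℕ) : ℤ)]
  linarith [h.1]

/-- The representations of a section as a combination of characters on the different charts agree,
by linear independence of characters; so only characters regular on every chart occur. -/
theorem torusRestrict_mem_span_monomial (hs : 1 ≤ s) (hr : 1 ≤ r) (σ : globalSections s a k l) :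
    torusRestrict σ ∈ Submodule.span ℂ (Set.range fun D : divisorSet s a k l =>
      torusRestrict (monomialSection D)) := by
  have hc := fun c => (Finsupp.mem_span_image_iff_linearCombination ℂ).1
    (torusRestrict_mem_span σ c)
  choose φ hφ hφσ using hc
  have hφ0 : ∀ c, φ c = φ (0, 0) := fun c =>
    linearIndependent_characterFun ((hφσ c).trans (hφσ (0, 0)).symm)
  have hmem : torusRestrict σ ∈
      Submodule.span ℂ (characterFun '' {e | ∀ c, e ∈ chartExponents a k l c}) := by
    refine (Finsupp.mem_span_image_iff_linearCombination ℂ).2 ⟨φ (0, 0), ?_, hφσ (0, 0)⟩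
    exact (Finsupp.mem_supported ℂ _).2 fun e he c =>
      (Finsupp.mem_supported ℂ _).1 (hφ c) (by rwa [hφ0 c])
  refine Submodule.span_mono ?_ hmem
  rintro _ ⟨e, he, rfl⟩
  obtain ⟨D, rfl⟩ := exists_divisor_of_mem_chartExponents hs hr he
  exact ⟨D, torusRestrict_monomialSection D⟩

theorem linearIndependent_monomialSection :
    LinearIndependent ℂ (monomialSection : divisorSet s a k l → globalSections s a k l) := by
  refine LinearIndependent.of_comp torusRestrict ?_
  have : (torusRestrict ∘ monomialSection : divisorSet s a k l → _) =
      characterFun ∘ fun (D : divisorSet s a k l) ρ => ((D : EffectiveToricDivisor s r) ρ : ℤ) :=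
    funext torusRestrict_monomialSection
  rw [this]
  refine linearIndependent_characterFun.comp _ fun D D' h => Subtype.ext (funext fun ρ => ?_)
  exact_mod_cast congrFun h ρ

theorem span_monomialSection (hs : 1 ≤ s) (hr : 1 ≤ r) :
    ⊤ ≤ Submodule.span ℂ (Set.range
      (monomialSection : divisorSet s a k l → globalSections s a k l)) := by
  intro σ _
  have h := torusRestrict_mem_span_monomial hs hr σ
  rw [Set.range_comp' torusRestrict monomialSection, ← Submodule.map_span] at h
  obtain ⟨τ, hτ, hτσ⟩ := h
  rwa [← torusRestrict_injective hτσ]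

end

end ProjBundle

end

theorem proposition4p1 (s r : ℕ) (hs : 1 ≤ s) (hr : 1 ≤ r) (a : Fin r → ℕ) (k l : ℤ) :
    ∃ b : Module.Basis (ProjBundle.divisorSet s a k l) ℂ (ProjBundle.globalSections s a k l),
      ∀ D : ProjBundle.divisorSet s a k l,
        ProjBundle.HasZeroDivisor a (b D : (x : ProjBundle.Space s a) → ProjBundle.lineFibre a k l x)
          (D : ProjBundle.EffectiveToricDivisor s r) := by
  refine ⟨Module.Basis.mk ProjBundle.linearIndependent_monomialSection
    (ProjBundle.span_monomialSection hs hr), fun D => ?_⟩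
  rw [Module.Basis.mk_apply]
  exact ProjBundle.hasZeroDivisor_monomialSection hs hr D
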